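/- Let $H_1,H_2,H_3$ be real Hilbert spaces, $K_1\subseteq H_1$ and $K_2\subseteq H_2$ nonempty closed convex sets, and $M:K_1\to(-\infty,+\infty]$, $N:K_2\to(-\infty,+\infty]$ proper lower semicontinuous convex functions (in particular, they may be real-valued). Let $D_1:H_1\to H_3$ and $D_2:H_2\to H_3$ be bounded linear operators with adjoints $D_1^*,D_2^*$, and put $L_1=\|D_1^*D_1\|$, $L_2=\|D_2^*D_2\|$. The split convex minimization problem (SCMP) is to find a point of $$\Gamma_3=\Big\{(p,q)\in K_1\times K_2:\ M(p)=\min_{K_1}M,\ N(q)=\min_{K_2}N,\ D_1p=D_2q\Big\}.$$ Assume $\Gamma_3\neq\emptyset$. Let $h(t,y)=M(y)-M(t)$ on $K_1\times K_1$ and $l(t,y)=N(y)-N(t)$ on $K_2\times K_2$ (with value $-\infty$ if the subtracted term is $+\infty$), and for a fixed $\lambda>0$ let $$R_{\lambda,h}(x)=\Big\{t\in K_1:\ h(t,y)+\tfrac1\lambda\langle y-t,t-x\rangle\ge 0\ \ \forall y\in K_1\Big\},\qquad R_{\lambda,l}(x)=\Big\{t\in K_2:\ l(t,y)+\tfrac1\lambda\langle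 y-t,t-x\rangle\ge 0\ \ \forall y\in K_2\Big\}$$ be the associated resolvents. Then $R_{\lambda,h}(x)$ is a singleton for every $x\in H_1$ and $R_{\lambda,l}(x)$ is a singleton for every $x\in H_2$, so that the resolvents are maps $H_1\to H_1$ and $H_2\to H_2$, and the SCMP is the split equality fixed-point problem for them: $$\Gamma_3=\{(p,q):\ p\in\mathrm{Fix}(R_{\lambda,h}),\ q\in\mathrm{Fix}(R_{\lambda,l}),\ D_1p=D_2q\}.$$ Moreover, let $R_{\lambda,h}$ be $L$-Lipschitz, let $0<\eta<\zeta<\frac{1}{1+\sqrt{1+L^2}}$, and let $$U=(1-\eta)I+\eta R_{\lambda,h}\big((1-\zeta)I+\zeta R_{\lambda,h}\big),\qquad V=(1-\eta)I+\eta R_{\lambda,l}\big((1-\zeta)I+\zeta R_{\lambda,l}\big).$$ Let $0<a<\alpha_n<1$ and $0<\tau_n<\frac{2}{L_1+L_2}$ for all $n$ (no upper bound on $\tau_n$ if $L_1+L_2=0$), with $\lim_{n\to\infty}\tau_n=0$ and $\sum_n\tau_n=\infty$. Then, for arbitrary $(x_0,y_0)\in H_1\times H_2$, the sequence defined for $n\ge0$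 by $$\begin{aligned}v_n&=(1-\tau_n)x_n+\tau_nUx_n+\tau_nD_1^*(D_2y_n-D_1x_n),& x_{n+1}&=(1-\alpha_n)v_n+\alpha_nUv_n,\\ w_n&=(1-\tau_n)y_n+\tau_nVy_n+\tau_nD_2^*(D_1x_n-D_2y_n),& y_{n+1}&=(1-\alpha_n)w_n+\alpha_nVw_n\end{aligned}$$ converges weakly to a solution of the SCMP: there is $(p,q)\in\Gamma_3$ with $x_n\rightharpoonup p$ and $y_n\rightharpoonup q$. -/

import Mathlib

open Filter Topology

namespace SplitConvex

/-- `M`, with values in `(-∞, +∞]` on `K`, is a proper lower semicontinuous convex function on `K`.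
A real-valued function on a nonempty `K` is the special case in which `M` is finite on `K`. Only
the values of `M` on `K` matter. -/
structure IsProperLscConvexOn {H : Type*} [NormedAddCommGroup H] [InnerProductSpace ℝ H]
    (M : H → EReal) (K : Set H) : Prop where
  ne_bot : ∀ x ∈ K, M x ≠ ⊥
  exists_ne_top : ∃ x ∈ K, M x ≠ ⊤
  lsc : LowerSemicontinuousOn M K
  convex : ∀ x ∈ K, ∀ y ∈ K, ∀ a b : ℝ, 0 ≤ a → 0 ≤ b → a + b = 1 →
    M (a • x + b • y) ≤ (a : EReal) * M x + (b : EReal) * M y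

/-- The bifunction `(t, y) ↦ M y - M t` attached to the minimization of `M`. In `EReal` its value
is `⊥` as soon as `M t = ⊤`. -/
noncomputable def minBifunction {H : Type*} (M : H → EReal) (t y : H) : EReal := M y - M t

/-- The (set-valued) resolvent of parameter `lam` of a bifunction `f` on `K`: the set of the
`t ∈ K` with `f t y + (1 / lam) ⟪y - t, t - x⟫ ≥ 0` for all `y ∈ K`. -/
def biResolvent {H : Type*} [NormedAddCommGroup H] [InnerProductSpace ℝ H]
    (K : Set H) (lam : ℝ) (f : H → H → EReal) (x : H) : Set H :=
  {t | t ∈ K ∧ ∀ y ∈ K, 0 ≤ f t y + ((1 / lam * inner ℝ (y - t) (t - x) : ℝ) : EReal)}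

open Classical in
/-- The resolvent as a map: an element of `biResolvent K lam f x` (and `x` itself where that set is
empty, which does not happen in the situation of the theorem). -/
noncomputable def resolventMap {H : Type*} [NormedAddCommGroup H] [InnerProductSpace ℝ H]
    (K : Set H) (lam : ℝ) (f : H → H → EReal) (x : H) : H :=
  if hx : (biResolvent K lam f x).Nonempty then hx.choose else x

/-- The Ishikawa-type map `(1 - η) I + η T ((1 - ζ) I + ζ T)`. -/
def ishikawa {H : Type*} [AddCommGroup H] [Module ℝ H] (η ζ : ℝ) (T : H → H) (x : H) : H :=
  (1 - η) • x + η • T ((1 - ζ) • x + ζ • T x)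

/-- The solution set of the split convex minimization problem: `p` minimizes `M` over `K₁`,
`q` minimizes `N` over `K₂`, and `D₁ p = D₂ q`. -/
def scmpSolutions {H₁ H₂ H₃ : Type*} (K₁ : Set H₁) (K₂ : Set H₂) (M : H₁ → EReal)
    (N : H₂ → EReal) (D₁ : H₁ → H₃) (D₂ : H₂ → H₃) : Set (H₁ × H₂) :=
  {z | z.1 ∈ K₁ ∧ z.2 ∈ K₂ ∧ IsMinOn M K₁ z.1 ∧ IsMinOn N K₂ z.2 ∧ D₁ z.1 = D₂ z.2}

/-- The solution set of the split equality fixed-point problem: `p ∈ Fix T₁`, `q ∈ Fix T₂`, and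
`D₁ p = D₂ q`. -/
def sefppSolutions {H₁ H₂ H₃ : Type*} (T₁ : H₁ → H₁) (T₂ : H₂ → H₂)
    (D₁ : H₁ → H₃) (D₂ : H₂ → H₃) : Set (H₁ × H₂) :=
  {z | z.1 ∈ Function.fixedPoints T₁ ∧ z.2 ∈ Function.fixedPoints T₂ ∧ D₁ z.1 = D₂ z.2}

/-- Weak convergence of a sequence in a real Hilbert space. -/
def WeaklyTendsto {H : Type*} [NormedAddCommGroup H] [InnerProductSpace ℝ H]
    (x : ℕ → H) (p : H) : Prop :=
  Tendsto (fun n => toWeakSpace ℝ H (x n)) atTop (𝓝 (toWeakSpace ℝ H p))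

end SplitConvex

/-! The resolvent of `minBifunction M` is the proximal map of `M`: its points minimize `M + ‖· - x‖²
/ (2 lam)`. Strong convexity and lower semicontinuity give existence, since a minimizer of `M`
bounds `M` below. Resolvents are nonexpansive and their fixed points are the minimizers of `M`.
Hence `U` and `V` are nonexpansive with the same fixed points, and being averaged they satisfy a
quasi-nonexpansive estimate with a gain `(1 - η) / η * ‖x - U x‖ ^ 2`.

On the Hilbert sum put `T = U × V` and `G (x, y) = D₁ x - D₂ y`. The scheme is then one sequence: a
step `v = z - τ ((z - T z) + G* G z)`, then relaxation by `T`. It is Fejér monotone with respect to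
`Fix T ∩ ker G`; the decrease gives `‖z - T z‖ → 0` and `∑ τ ‖G z‖² < ∞`. Demiclosedness puts every
weak cluster point in `Fix T`, and Opial's lemma would finish if they also lay in `ker G`.

That is the difficulty: as `τ → 0`, summability does not directly give `G z → 0`. Since `∑ τ = ∞`,
from each `n` there is a later `m n` where `G z` is small, with `∑ τ` over `[n, m n)` tending to `0`
(`exists_visit_of_summable_mul`). Over that stretch the distance to any fixed point of `T` grows by
`o(1)`. This forces the weak limits of `z n` and `z (m n)` along one ultrafilter to agree, and the
latter is in `ker G`. -/

namespace SplitConvex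

/-! ### The resolvent of `minBifunction M` as a proximal map -/

section Resolvent

variable {H : Type*} [NormedAddCommGroup H] [InnerProductSpace ℝ H]

/-- The effective domain of `M` in `K`. -/
def finiteDomain (M : H → EReal) (K : Set H) : Set H := {x | x ∈ K ∧ M x ≠ ⊤}

theorem IsProperLscConvexOn.coe_toReal {M : H → EReal} {K : Set H}
    (hM : IsProperLscConvexOn M K) {x : H} (hx : x ∈ finiteDomain M K) :
    ((M x).toReal : EReal) = M x :=
  EReal.coe_toReal hx.2 (hM.ne_bot x hx.1)

theorem IsProperLscConvexOn.convexOn_toReal {M : H → EReal} {K : Set H}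
    (hM : IsProperLscConvexOn M K) (hK : Convex ℝ K) :
    ConvexOn ℝ (finiteDomain M K) (fun x => (M x).toReal) := by
  have key : ∀ x ∈ finiteDomain M K, ∀ y ∈ finiteDomain M K, ∀ a b : ℝ, 0 ≤ a → 0 ≤ b →
      a + b = 1 → M (a • x + b • y) ≤ ((a * (M x).toReal + b * (M y).toReal : ℝ) : EReal) := by
    intro x hx y hy a b ha hb hab
    have h := hM.convex x hx.1 y hy.1 a b ha hb hab
    rw [← hM.coe_toReal hx, ← hM.coe_toReal hy] at h
    exact_mod_cast h
  have mem : Convex ℝ (finiteDomain M K) := fun x hx y hy a b ha hb hab =>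
    ⟨hK hx.1 hy.1 ha hb hab,
      ne_top_of_le_ne_top (EReal.coe_ne_top _) (key x hx y hy a b ha hb hab)⟩
  refine ⟨mem, fun x hx y hy a b ha hb hab => ?_⟩
  have h := key x hx y hy a b ha hb hab
  rw [← hM.coe_toReal (mem hx hy ha hb hab)] at h
  exact_mod_cast h

theorem IsProperLscConvexOn.toReal_le_of_tendsto {M : H → EReal} {K : Set H}
    (hM : IsProperLscConvexOn M K) {y : ℕ → H} (hy : ∀ n, y n ∈ finiteDomain M K) {t : H}
    (ht : t ∈ K) (hyt : Tendsto y atTop (𝓝 t)) {r : ℝ}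
    (hr : Tendsto (fun n => (M (y n)).toReal) atTop (𝓝 r)) :
    t ∈ finiteDomain M K ∧ (M t).toReal ≤ r := by
  have hle : M t ≤ (r : EReal) := by
    by_contra! hlt
    obtain ⟨b, hrb, hbt⟩ := EReal.lt_iff_exists_real_btwn.1 hlt
    have h1 : ∀ᶠ n in atTop, (b : EReal) < M (y n) :=
      (tendsto_nhdsWithin_iff.2 ⟨hyt, Eventually.of_forall fun n => (hy n).1⟩).eventually
        (hM.lsc t ht b hbt)
    have h2 : ∀ᶠ n in atTop, (M (y n)).toReal < b :=
      hr.eventually (gt_mem_nhds (by exact_mod_cast hrb))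
    obtain ⟨n, hn1, hn2⟩ := (h1.and h2).exists
    rw [← hM.coe_toReal (hy n)] at hn1
    exact lt_asymm hn2 (by exact_mod_cast hn1)
  have hmem : t ∈ finiteDomain M K := ⟨ht, ne_top_of_le_ne_top (EReal.coe_ne_top _) hle⟩
  refine ⟨hmem, ?_⟩
  rw [← hM.coe_toReal hmem] at hle
  exact_mod_cast hle

theorem IsProperLscConvexOn.mem_biResolvent_iff {M : H → EReal} {K : Set H}
    (hM : IsProperLscConvexOn M K) {lam : ℝ} {x t : H} :
    t ∈ biResolvent K lam (minBifunction M) x ↔ t ∈ finiteDomain M K ∧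
      ∀ y ∈ finiteDomain M K,
        (M t).toReal ≤ (M y).toReal + 1 / lam * inner ℝ (y - t) (t - x) := by
  have real_iff : ∀ {y}, t ∈ finiteDomain M K → y ∈ finiteDomain M K →
      (0 ≤ minBifunction M t y + ((1 / lam * inner ℝ (y - t) (t - x) : ℝ) : EReal) ↔
        (M t).toReal ≤ (M y).toReal + 1 / lam * inner ℝ (y - t) (t - x)) := by
    intro y ht hy
    rw [minBifunction, ← hM.coe_toReal ht, ← hM.coe_toReal hy, ← EReal.coe_sub, ← EReal.coe_add,
      EReal.coe_nonneg, EReal.toReal_coe, EReal.toReal_coe]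
    constructor <;> intro h <;> linarith
  constructor
  · rintro ⟨htK, h⟩
    have ht : t ∈ finiteDomain M K := by
      refine ⟨htK, fun htop => ?_⟩
      -- If `M t = ⊤`, the test point `y = t` already fails: `⊤ - ⊤ = ⊥` in `EReal`.
      have := h t htK
      rw [minBifunction, htop, sub_eq_add_neg, EReal.neg_top, EReal.add_bot, EReal.bot_add] at this
      exact absurd this (by simp)
    exact ⟨ht, fun y hy => (real_iff ht hy).1 (h y hy.1)⟩
  · rintro ⟨ht, h⟩
    refine ⟨ht.1, fun y hy => ?_⟩
    by_cases hyt : M y = ⊤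
    · rw [minBifunction, hyt, ← hM.coe_toReal ht, EReal.top_sub_coe, EReal.top_add_coe]
      exact le_top
    · exact (real_iff ht ⟨hy, hyt⟩).2 (h y ⟨hy, hyt⟩)

/-- Testing each of the two inequalities at the other point and adding cancels the values of `M`;
what remains is firm nonexpansiveness, `‖t - t'‖² ≤ ⟪t - t', x - x'⟫`. The case `x = x'` gives
uniqueness. -/
theorem IsProperLscConvexOn.biResolvent_norm_sub_le {M : H → EReal} {K : Set H}
    (hM : IsProperLscConvexOn M K) {lam : ℝ} (hlam : 0 < lam) {x x' t t' : H}
    (ht : t ∈ biResolvent K lam (minBifunction M) x)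
    (ht' : t' ∈ biResolvent K lam (minBifunction M) x') : ‖t - t'‖ ≤ ‖x - x'‖ := by
  rw [hM.mem_biResolvent_iff] at ht ht'
  have h1 := ht.2 t' ht'.1
  have h2 := ht'.2 t ht.1
  have h3 : 0 ≤ 1 / lam * (inner ℝ (t' - t) (t - x) + inner ℝ (t - t') (t' - x')) := by
    rw [mul_add]; linarith
  have h4 := nonneg_of_mul_nonneg_right h3 (by positivity)
  have h5 : inner ℝ (t' - t) (t - x) + inner ℝ (t - t') (t' - x') =
      inner ℝ (t - t') (x - x') - ‖t - t'‖ ^ 2 := by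
    rw [← real_inner_self_eq_norm_sq, ← neg_sub t t', inner_neg_left]
    simp only [inner_sub_left, inner_sub_right]
    ring
  have h6 := real_inner_le_norm (t - t') (x - x')
  by_contra! hlt
  nlinarith [norm_nonneg (x - x'), norm_nonneg (t - t')]

theorem norm_sub_sq_add_smul (s : ℝ) (t y x : H) :
    ‖((1 - s) • t + s • y) - x‖ ^ 2 =
      ‖t - x‖ ^ 2 + 2 * s * inner ℝ (y - t) (t - x) + s ^ 2 * ‖y - t‖ ^ 2 := by
  have : ((1 - s) • t + s • y) - x = (t - x) + s • (y - t) := by module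
  rw [this, norm_add_sq_real, real_inner_smul_right, real_inner_comm, norm_smul, mul_pow,
    Real.norm_eq_abs, sq_abs]
  ring

/-- Minimizers of the Moreau regularization belong to the resolvent. -/
theorem IsProperLscConvexOn.mem_biResolvent_of_isMinOn {M : H → EReal} {K : Set H}
    (hM : IsProperLscConvexOn M K) (hK : Convex ℝ K) {lam : ℝ} (hlam : 0 < lam) {x t : H}
    (ht : t ∈ finiteDomain M K)
    (hmin : ∀ y ∈ finiteDomain M K, (M t).toReal + 1 / (2 * lam) * ‖t - x‖ ^ 2 ≤
      (M y).toReal + 1 / (2 * lam) * ‖y - x‖ ^ 2) :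
    t ∈ biResolvent K lam (minBifunction M) x := by
  refine hM.mem_biResolvent_iff.2 ⟨ht, fun y hy => ?_⟩
  have hconv := hM.convexOn_toReal hK
  -- Compare `t` with the point a fraction `s` of the way to `y`, use convexity and divide by `s`;
  -- the last term disappears as `s → 0`.
  have key : ∀ s : ℝ, s ∈ Set.Ioo (0 : ℝ) 1 → (M t).toReal ≤ (M y).toReal +
      1 / lam * inner ℝ (y - t) (t - x) + s * (1 / (2 * lam) * ‖y - t‖ ^ 2) := by
    intro s hs
    have h1 := hmin _ (hconv.1 ht hy (sub_nonneg.2 hs.2.le) hs.1.le (sub_add_cancel 1 s))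
    have h2 := hconv.2 ht hy (sub_nonneg.2 hs.2.le) hs.1.le (sub_add_cancel 1 s)
    simp only [smul_eq_mul] at h2
    rw [norm_sub_sq_add_smul] at h1
    have h3 : 1 / (2 * lam) = 1 / lam / 2 := by field_simp
    rw [h3] at h1 ⊢
    refine le_of_mul_le_mul_left ?_ hs.1
    nlinarith
  have hlim : Tendsto (fun s : ℝ => (M y).toReal + 1 / lam * inner ℝ (y - t) (t - x) +
      s * (1 / (2 * lam) * ‖y - t‖ ^ 2)) (𝓝[>] 0)
      (𝓝 ((M y).toReal + 1 / lam * inner ℝ (y - t) (t - x) +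
        0 * (1 / (2 * lam) * ‖y - t‖ ^ 2))) :=
    (Continuous.tendsto (by fun_prop) 0).mono_left nhdsWithin_le_nhds
  rw [zero_mul, add_zero] at hlim
  exact ge_of_tendsto hlim (eventually_of_mem (Ioo_mem_nhdsGT one_pos) key)

/-- Strong convexity of the regularized function makes any minimizing sequence Cauchy, and lower
semicontinuity makes its limit a minimizer. -/
theorem IsProperLscConvexOn.exists_regularized_min [CompleteSpace H] {M : H → EReal} {K : Set H}
    (hM : IsProperLscConvexOn M K) (hKc : IsClosed K) (hK : Convex ℝ K) {lam : ℝ} (hlam : 0 < lam)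
    {c : ℝ} (hc : ∀ y ∈ finiteDomain M K, c ≤ (M y).toReal) (x : H) :
    ∃ t ∈ finiteDomain M K, ∀ y ∈ finiteDomain M K,
      (M t).toReal + 1 / (2 * lam) * ‖t - x‖ ^ 2 ≤
        (M y).toReal + 1 / (2 * lam) * ‖y - x‖ ^ 2 := by
  set φ : H → ℝ := fun y => (M y).toReal + 1 / (2 * lam) * ‖y - x‖ ^ 2 with hφ
  have hconv := hM.convexOn_toReal hK
  set S : Set ℝ := φ '' finiteDomain M K with hS
  have hSne : S.Nonempty := by
    obtain ⟨z, hz, hz'⟩ := hM.exists_ne_top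
    exact ⟨φ z, z, ⟨hz, hz'⟩, rfl⟩
  have hSb : BddBelow S := by
    refine ⟨c, ?_⟩
    rintro _ ⟨y, hy, rfl⟩
    have : 0 ≤ 1 / (2 * lam) * ‖y - x‖ ^ 2 := by positivity
    have := hc y hy
    simp only [hφ]; linarith
  have hinf : ∀ y ∈ finiteDomain M K, sInf S ≤ φ y := fun y hy => csInf_le hSb ⟨y, hy, rfl⟩
  have hex : ∀ n : ℕ, ∃ y ∈ finiteDomain M K, φ y < sInf S + 1 / ((n : ℝ) + 1) := by
    intro n
    obtain ⟨_, ⟨y, hy, rfl⟩, hlt⟩ := exists_lt_of_csInf_lt hSne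
      (lt_add_of_pos_right (sInf S) (Nat.one_div_pos_of_nat (α := ℝ) (n := n)))
    exact ⟨y, hy, hlt⟩
  choose y hy hylt using hex
  have hone : Tendsto (fun n : ℕ => 1 / ((n : ℝ) + 1)) atTop (𝓝 0) :=
    tendsto_one_div_add_atTop_nhds_zero_nat
  have hφlim : Tendsto (fun n => φ (y n)) atTop (𝓝 (sInf S)) := by
    refine tendsto_of_tendsto_of_tendsto_of_le_of_le tendsto_const_nhds ?_
      (fun n => hinf _ (hy n)) (fun n => (hylt n).le)
    simpa using hone.const_add (sInf S)
  -- The midpoint of `y m` and `y n` has value at least the infimum, while its quadratic term lies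
  -- `‖y m - y n‖² / (8 lam)` below the average of the two.
  have hmid : ∀ m n, ‖y m - y n‖ ^ 2 ≤ 4 * lam * ((φ (y m) - sInf S) + (φ (y n) - sInf S)) := by
    intro m n
    have hmem := hconv.1 (hy m) (hy n) (show (0 : ℝ) ≤ 1 - 1 / 2 by norm_num)
      (show (0 : ℝ) ≤ 1 / 2 by norm_num) (by norm_num)
    have h1 := hinf _ hmem
    have h2 := hconv.2 (hy m) (hy n) (show (0 : ℝ) ≤ 1 - 1 / 2 by norm_num)
      (show (0 : ℝ) ≤ 1 / 2 by norm_num) (by norm_num)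
    have h4 := norm_sub_sq_add_smul 1 (y m) (y n) x
    have h3 := norm_sub_sq_add_smul (1 / 2) (y m) (y n) x
    rw [sub_self, zero_smul, zero_add, one_smul] at h4
    simp only [smul_eq_mul] at h2
    simp only [hφ] at h1 ⊢
    have h5 : 1 / (2 * lam) * ‖y n - y m‖ ^ 2 / 4 ≤
        ((M (y m)).toReal + 1 / (2 * lam) * ‖y m - x‖ ^ 2 - sInf S +
          ((M (y n)).toReal + 1 / (2 * lam) * ‖y n - x‖ ^ 2 - sInf S)) / 2 := by
      rw [h3] at h1
      rw [h4]
      linarith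
    rw [norm_sub_rev]
    have h6 := mul_le_mul_of_nonneg_left h5 (show 0 ≤ 8 * lam by positivity)
    have h7 : 8 * lam * (1 / (2 * lam) * ‖y n - y m‖ ^ 2 / 4) = ‖y n - y m‖ ^ 2 := by
      field_simp
      ring
    rw [h7] at h6
    linarith
  have hcauchy : CauchySeq y := by
    refine Metric.cauchySeq_iff'.2 fun ε hε => ?_
    have hpos : 0 < ε ^ 2 / (8 * lam) := by positivity
    have hev := hφlim.eventually (gt_mem_nhds (lt_add_of_pos_right (sInf S) hpos))
    obtain ⟨n₀, hn₀⟩ := eventually_atTop.1 hev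
    refine ⟨n₀, fun n hn => ?_⟩
    have h1 := hn₀ n hn
    have h2 := hn₀ n₀ le_rfl
    have h3 := hmid n n₀
    rw [dist_eq_norm]
    refine lt_of_pow_lt_pow_left₀ 2 hε.le (h3.trans_lt ?_)
    have h4 : (φ (y n) - sInf S) + (φ (y n₀) - sInf S) <
        ε ^ 2 / (8 * lam) + ε ^ 2 / (8 * lam) := by linarith
    calc _ < 4 * lam * (ε ^ 2 / (8 * lam) + ε ^ 2 / (8 * lam)) :=
          mul_lt_mul_of_pos_left h4 (by positivity)
      _ = ε ^ 2 := by field_simp; ring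
  obtain ⟨t, ht⟩ := cauchySeq_tendsto_of_complete hcauchy
  have htK : t ∈ K := hKc.mem_of_tendsto ht (Eventually.of_forall fun n => (hy n).1)
  have hlim : Tendsto (fun n => (M (y n)).toReal) atTop
      (𝓝 (sInf S - 1 / (2 * lam) * ‖t - x‖ ^ 2)) := by
    have h := hφlim.sub ((((ht.sub_const x).norm).pow 2).const_mul (1 / (2 * lam)))
    refine h.congr fun n => ?_
    simp only [hφ]; ring
  obtain ⟨hmem, hle⟩ := hM.toReal_le_of_tendsto hy htK ht hlim
  exact ⟨t, hmem, fun z hz => (by linarith : _ ≤ sInf S).trans (hinf z hz)⟩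

theorem IsProperLscConvexOn.mem_finiteDomain_of_isMinOn {M : H → EReal} {K : Set H}
    (hM : IsProperLscConvexOn M K) {p : H} (hp : p ∈ K) (hmin : IsMinOn M K p) :
    p ∈ finiteDomain M K := by
  obtain ⟨z, hz, hz'⟩ := hM.exists_ne_top
  exact ⟨hp, ne_top_of_le_ne_top hz' (hmin hz)⟩

theorem IsProperLscConvexOn.isMinOn_iff_toReal {M : H → EReal} {K : Set H}
    (hM : IsProperLscConvexOn M K) {p : H} :
    (p ∈ K ∧ IsMinOn M K p) ↔ p ∈ finiteDomain M K ∧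
      ∀ y ∈ finiteDomain M K, (M p).toReal ≤ (M y).toReal := by
  constructor
  · rintro ⟨hp, hmin⟩
    have hpd := hM.mem_finiteDomain_of_isMinOn hp hmin
    refine ⟨hpd, fun y hy => EReal.toReal_le_toReal (hmin hy.1) (hM.ne_bot p hp) hy.2⟩
  · rintro ⟨hp, h⟩
    refine ⟨hp.1, fun y hy => ?_⟩
    by_cases hyt : M y = ⊤
    · simp [hyt]
    · have := h y ⟨hy, hyt⟩
      change M p ≤ M y
      rw [← hM.coe_toReal hp, ← hM.coe_toReal ⟨hy, hyt⟩]
      exact_mod_cast this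

theorem IsProperLscConvexOn.biResolvent_eq_singleton [CompleteSpace H] {M : H → EReal} {K : Set H}
    (hM : IsProperLscConvexOn M K) (hKc : IsClosed K) (hK : Convex ℝ K) {lam : ℝ} (hlam : 0 < lam)
    {p : H} (hp : p ∈ K) (hmin : IsMinOn M K p) (x : H) :
    biResolvent K lam (minBifunction M) x = {resolventMap K lam (minBifunction M) x} := by
  obtain ⟨t, ht, htmin⟩ := hM.exists_regularized_min hKc hK hlam
    (hM.isMinOn_iff_toReal.1 ⟨hp, hmin⟩).2 x
  have hne : (biResolvent K lam (minBifunction M) x).Nonempty :=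
    ⟨t, hM.mem_biResolvent_of_isMinOn hK hlam ht htmin⟩
  have hmem : resolventMap K lam (minBifunction M) x ∈ biResolvent K lam (minBifunction M) x := by
    rw [resolventMap, dif_pos hne]
    exact hne.choose_spec
  refine Set.eq_singleton_iff_unique_mem.2 ⟨hmem, fun s hs => ?_⟩
  have := hM.biResolvent_norm_sub_le hlam hs hmem
  rw [sub_self, norm_zero] at this
  exact sub_eq_zero.1 (norm_le_zero_iff.1 this)

theorem IsProperLscConvexOn.mem_biResolvent_self_iff {M : H → EReal} {K : Set H}
    (hM : IsProperLscConvexOn M K) {lam : ℝ} {p : H} :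
    p ∈ biResolvent K lam (minBifunction M) p ↔ p ∈ K ∧ IsMinOn M K p := by
  rw [hM.mem_biResolvent_iff, hM.isMinOn_iff_toReal]
  simp

end Resolvent

/-! ### Visits to small values at vanishing cost -/

/-- If `∑ τ s < ∞` and `∑ τ = ∞`, then from every index `n` one reaches an index `m n` at which `s`
is small, at a vanishing cost in `τ`. -/
theorem exists_visit_of_summable_mul {τ s : ℕ → ℝ} (hτ : ∀ n, 0 ≤ τ n) (hs : ∀ n, 0 ≤ s n)
    (hsum : Summable fun n => τ n * s n)
    (hdiv : Tendsto (fun n => ∑ i ∈ Finset.range n, τ i) atTop atTop) :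
    ∃ m : ℕ → ℕ, (∀ n, n ≤ m n) ∧ Tendsto (fun n => s (m n)) atTop (𝓝 0) ∧
      Tendsto (fun n => ∑ j ∈ Finset.Ico n (m n), τ j) atTop (𝓝 0) := by
  set δ : ℕ → ℝ := fun n => ∑' k, τ (k + n) * s (k + n) with hδ
  have hδlim : Tendsto δ atTop (𝓝 0) := tendsto_sum_nat_add fun n => τ n * s n
  have hδ0 : ∀ n, 0 ≤ δ n := fun n => tsum_nonneg fun k => mul_nonneg (hτ _) (hs _)
  have hδsum : ∀ n m, ∑ j ∈ Finset.Ico n m, τ j * s j ≤ δ n := by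
    intro n m
    rw [Finset.sum_Ico_eq_sum_range]
    simp only [add_comm n]
    exact ((summable_nat_add_iff n).2 hsum).sum_le_tsum _
      fun k _ => mul_nonneg (hτ _) (hs _)
  -- The threshold balances two demands: `ε → 0`, and the cost `δ / ε ≤ √δ → 0`. The summand `1 / (n
  -- + 1)` only keeps `ε` positive.
  set ε : ℕ → ℝ := fun n => √(δ n) + 1 / ((n : ℝ) + 1) with hε
  have hεpos : ∀ n, 0 < ε n := fun n =>
    add_pos_of_nonneg_of_pos (Real.sqrt_nonneg _) Nat.one_div_pos_of_nat
  have hsqrtlim : Tendsto (fun n => √(δ n)) atTop (𝓝 0) := by simpa using hδlim.sqrt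
  have hεlim : Tendsto ε atTop (𝓝 0) := by
    simpa only [add_zero] using hsqrtlim.add (tendsto_one_div_add_atTop_nhds_zero_nat (𝕜 := ℝ))
  have hex : ∀ n, ∃ j, n ≤ j ∧ s j < ε n := by
    intro n
    by_contra! hcon
    have hτsum : Summable τ := by
      refine (summable_nat_add_iff n).1 (Summable.of_nonneg_of_le (fun k => hτ _) (fun k => ?_)
        (((summable_nat_add_iff n).2 hsum).mul_right (ε n)⁻¹))
      rw [← div_eq_mul_inv, le_div_iff₀ (hεpos n)]
      exact mul_le_mul_of_nonneg_left (hcon _ (Nat.le_add_left n k)) (hτ _)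
    exact not_tendsto_nhds_of_tendsto_atTop hdiv _ hτsum.tendsto_sum_tsum_nat
  classical
  refine ⟨fun n => Nat.find (hex n), fun n => (Nat.find_spec (hex n)).1, ?_, ?_⟩
  · exact squeeze_zero (fun n => hs _) (fun n => (Nat.find_spec (hex n)).2.le) hεlim
  · refine squeeze_zero (fun n => Finset.sum_nonneg fun j _ => hτ j) (fun n => ?_) hsqrtlim
    -- Before the first visit `s j ≥ ε n`, so the tail sum `δ n` pays for `ε n * ∑ τ j`.
    have h1 : (∑ j ∈ Finset.Ico n (Nat.find (hex n)), τ j) * ε n ≤ δ n := by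
      refine le_trans ?_ (hδsum n (Nat.find (hex n)))
      rw [Finset.sum_mul]
      refine Finset.sum_le_sum fun j hj => mul_le_mul_of_nonneg_left ?_ (hτ j)
      have := Nat.find_min (hex n) (Finset.mem_Ico.1 hj).2
      by_contra! hlt
      exact this ⟨(Finset.mem_Ico.1 hj).1, hlt⟩
    refine le_of_mul_le_mul_right (h1.trans ?_) (hεpos n)
    have h2 : 0 < 1 / ((n : ℝ) + 1) := Nat.one_div_pos_of_nat
    have h3 := Real.mul_self_sqrt (hδ0 n)
    have h4 := Real.sqrt_nonneg (δ n)
    simp only [hε]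
    nlinarith

/-! ### Weak limits along ultrafilters, demiclosedness and Opial's lemma -/

section WeakLimit

variable {E : Type*} [NormedAddCommGroup E] [InnerProductSpace ℝ E]

/-- Weak convergence along a filter, tested against inner products. -/
def WeakLim {ι : Type*} (F : Filter ι) (z : ι → E) (c : E) : Prop :=
  ∀ w, Tendsto (fun i => inner ℝ (z i) w) F (𝓝 (inner ℝ c w))

theorem WeakLim.sub_const {ι : Type*} {F : Filter ι} {z : ι → E} {c : E} (h : WeakLim F z c)
    (a w : E) : Tendsto (fun i => inner ℝ (z i - a) w) F (𝓝 (inner ℝ (c - a) w)) := by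
  simp only [inner_sub_left]
  exact (h w).sub_const _

/-- Banach–Alaoglu carried over by the Riesz isometry. Ultrafilters take the place of subsequences,
so no separability is needed. -/
theorem exists_weakLim_ultrafilter [CompleteSpace E] {ι : Type*} (F : Ultrafilter ι) {z : ι → E}
    {R : ℝ} (hz : ∀ i, ‖z i‖ ≤ R) : ∃ c, WeakLim (F : Filter ι) z c := by
  let u : ι → WeakDual ℝ E := fun i =>
    StrongDual.toWeakDual (InnerProductSpace.toDual ℝ E (z i))
  have hmem : ∀ i, u i ∈ WeakDual.toStrongDual ⁻¹'
      Metric.closedBall (0 : StrongDual ℝ E) R := by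
    intro i
    change InnerProductSpace.toDual ℝ E (z i) ∈ Metric.closedBall (0 : StrongDual ℝ E) R
    rw [mem_closedBall_zero_iff, LinearIsometryEquiv.norm_map]
    exact hz i
  obtain ⟨φ, -, hφ⟩ := (WeakDual.isCompact_closedBall (0 : StrongDual ℝ E) R).ultrafilter_le_nhds
    (F.map u) (le_principal_iff.2 (Ultrafilter.mem_map.2 (univ_mem' hmem)))
  refine ⟨(InnerProductSpace.toDual ℝ E).symm (WeakDual.toStrongDual φ), fun w => ?_⟩
  rw [InnerProductSpace.toDual_symm_apply]
  exact (WeakDual.eval_continuous w).continuousAt.tendsto.comp hφ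

theorem weaklyTendsto_iff_weakLim [CompleteSpace E] {x : ℕ → E} {p : E} :
    WeaklyTendsto x p ↔ WeakLim atTop x p := by
  have hinj : Function.Injective (topDualPairing ℝ E).flip := by
    intro a b hab
    refine ext_inner_right ℝ fun w => ?_
    have h : InnerProductSpace.toDual ℝ E w a = InnerProductSpace.toDual ℝ E w b :=
      LinearMap.congr_fun hab (InnerProductSpace.toDual ℝ E w)
    rw [InnerProductSpace.toDual_apply_apply, InnerProductSpace.toDual_apply_apply] at h
    rwa [real_inner_comm, real_inner_comm w b]
  refine (WeakBilin.tendsto_iff_forall_eval_tendsto _ hinj).trans ⟨fun h w => ?_, fun h l => ?_⟩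
  · have := h (InnerProductSpace.toDual ℝ E w)
    change Tendsto (fun i => InnerProductSpace.toDual ℝ E w (x i)) atTop
      (𝓝 (InnerProductSpace.toDual ℝ E w p)) at this
    simpa only [InnerProductSpace.toDual_apply_apply, real_inner_comm] using this
  · change Tendsto (fun i => l (x i)) atTop (𝓝 (l p))
    have := h ((InnerProductSpace.toDual ℝ E).symm l)
    simpa only [real_inner_comm _ (x _), real_inner_comm _ p,
      InnerProductSpace.toDual_symm_apply] using this

theorem norm_sub_sq_expand (z b c : E) :
    ‖z - b‖ ^ 2 = ‖z - c‖ ^ 2 + 2 * inner ℝ (z - c) (c - b) + ‖c - b‖ ^ 2 := by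
  rw [← norm_add_sq_real, sub_add_sub_cancel]

theorem norm_convexComb_sub_sq (r : ℝ) (u v p : E) :
    ‖((1 - r) • u + r • v) - p‖ ^ 2 =
      (1 - r) * ‖u - p‖ ^ 2 + r * ‖v - p‖ ^ 2 - r * (1 - r) * ‖u - v‖ ^ 2 := by
  have h1 := norm_sub_sq_add_smul r u v p
  have h2 := norm_sub_sq_add_smul 1 u v p
  rw [sub_self, zero_smul, zero_add, one_smul] at h2
  rw [h1, h2, norm_sub_rev u v]
  ring

/-- Demiclosedness of `I - T` at `0` for a nonexpansive `T`. -/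
theorem WeakLim.isFixedPt {ι : Type*} {F : Filter ι} [F.NeBot] {z : ι → E} {c : E}
    (h : WeakLim F z c) {T : E → E} (hT : ∀ x y, ‖T x - T y‖ ≤ ‖x - y‖) {R : ℝ}
    (hR : ∀ i, ‖z i - c‖ ≤ R) (hz : Tendsto (fun i => ‖z i - T (z i)‖) F (𝓝 0)) : T c = c := by
  -- Square `‖z i - T c‖ ≤ ‖z i - T (z i)‖ + ‖z i - c‖` and expand the left side around `c`.
  have key : ∀ i, 2 * inner ℝ (z i - c) (c - T c) + ‖c - T c‖ ^ 2 ≤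
      ‖z i - T (z i)‖ ^ 2 + 2 * R * ‖z i - T (z i)‖ := by
    intro i
    have h1 := norm_sub_sq_expand (z i) (T c) c
    have h2 : ‖z i - T c‖ ≤ ‖z i - T (z i)‖ + ‖z i - c‖ :=
      (norm_sub_le_norm_sub_add_norm_sub _ (T (z i)) _).trans (by gcongr; exact hT _ _)
    have h3 := hR i
    have h4 := pow_le_pow_left₀ (norm_nonneg _) h2 2
    nlinarith [norm_nonneg (z i - T (z i))]
  have hl := ((h.sub_const c (c - T c)).const_mul 2).add_const (‖c - T c‖ ^ 2)
  have hr := (hz.pow 2).add (hz.const_mul (2 * R))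
  have := le_of_tendsto_of_tendsto hl hr (Eventually.of_forall key)
  simp only [sub_self, inner_zero_left, mul_zero, zero_add, ne_eq, OfNat.ofNat_ne_zero,
    not_false_eq_true, zero_pow] at this
  have h0 : ‖c - T c‖ = 0 := by nlinarith [norm_nonneg (c - T c)]
  exact (sub_eq_zero.1 (norm_eq_zero.1 h0)).symm

/-- A continuous linear map with `‖G zᵢ‖ → 0` vanishes at the weak limit. -/
theorem WeakLim.map_eq_zero {E' : Type*} [NormedAddCommGroup E'] [InnerProductSpace ℝ E']
    [CompleteSpace E] [CompleteSpace E'] {ι : Type*} {F : Filter ι} [F.NeBot] {z : ι → E} {c : E}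
    (h : WeakLim F z c) (G : E →L[ℝ] E') (hz : Tendsto (fun i => ‖G (z i)‖) F (𝓝 0)) :
    G c = 0 := by
  have h1 := h (ContinuousLinearMap.adjoint G (G c))
  simp only [ContinuousLinearMap.adjoint_inner_right] at h1
  have h2 : Tendsto (fun i => inner ℝ (G (z i)) (G c)) F (𝓝 0) := by
    refine squeeze_zero_norm (fun i => norm_inner_le_norm _ _) ?_
    simpa using hz.mul_const ‖G c‖
  exact inner_self_eq_zero.1 (tendsto_nhds_unique h1 h2)

/-- Opial's lemma: if the distances to all points of `S` converge and all weak limits along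
ultrafilters lie in `S`, then the sequence converges weakly to a point of `S`. -/
theorem exists_weakLim_of_opial [CompleteSpace E] {z : ℕ → E} {S : Set E} {R : ℝ}
    (hR : ∀ n, ‖z n‖ ≤ R)
    (hdist : ∀ p ∈ S, ∃ l, Tendsto (fun n => ‖z n - p‖ ^ 2) atTop (𝓝 l))
    (hclus : ∀ (F : Ultrafilter ℕ) (c : E), (F : Filter ℕ) ≤ atTop → WeakLim (F : Filter ℕ) z c →
      c ∈ S) :
    ∃ p ∈ S, WeakLim atTop z p := by
  obtain ⟨F, hF⟩ := Ultrafilter.exists_le (atTop : Filter ℕ)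
  obtain ⟨p, hp⟩ := exists_weakLim_ultrafilter F hR
  have hpS := hclus F p hF hp
  refine ⟨p, hpS, fun w => (tendsto_iff_ultrafilter _ _ _).2 fun F' hF' => ?_⟩
  obtain ⟨p', hp'⟩ := exists_weakLim_ultrafilter F' hR
  have hpS' := hclus F' p' hF' hp'
  suffices p' = p from this ▸ hp' w
  obtain ⟨l, hl⟩ := hdist p hpS
  obtain ⟨l', hl'⟩ := hdist p' hpS'
  -- This inner product converges along the whole sequence, so its limits along `F` and `F'`, namely
  -- `0` and `-2 ‖p - p'‖²`, coincide.
  have hlim : Tendsto (fun n => 2 * inner ℝ (z n - p) (p - p')) atTop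
      (𝓝 (l' - l - ‖p - p'‖ ^ 2)) := by
    refine ((hl'.sub hl).sub_const (‖p - p'‖ ^ 2)).congr fun n => ?_
    rw [norm_sub_sq_expand (z n) p' p]
    ring
  have h1 := tendsto_nhds_unique (hlim.mono_left hF) ((hp.sub_const p (p - p')).const_mul 2)
  have h2 := tendsto_nhds_unique (hlim.mono_left hF') ((hp'.sub_const p (p - p')).const_mul 2)
  rw [h1, sub_self, inner_zero_left, mul_zero, ← neg_sub p p', inner_neg_left,
    real_inner_self_eq_norm_sq] at h2
  have h0 : ‖p - p'‖ = 0 := by nlinarith [norm_nonneg (p - p')]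
  exact (sub_eq_zero.1 (norm_eq_zero.1 h0)).symm

end WeakLimit

/-! ### The relaxed forward iteration on one Hilbert space -/

section Iteration

variable {E E' : Type*} [NormedAddCommGroup E] [InnerProductSpace ℝ E] [CompleteSpace E]
  [NormedAddCommGroup E'] [InnerProductSpace ℝ E'] [CompleteSpace E']

open ContinuousLinearMap in
/-- The forward step `z - τ ((z - T z) + G* G z)`. -/
noncomputable def forwardStep (T : E → E) (G : E →L[ℝ] E') (τ : ℝ) (z : E) : E :=
  z - τ • ((z - T z) + adjoint G (G z))

theorem norm_adjoint_apply_le (G : E →L[ℝ] E') (u : E') :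
    ‖ContinuousLinearMap.adjoint G u‖ ≤ ‖G‖ * ‖u‖ := by
  have h := (ContinuousLinearMap.adjoint G).le_opNorm u
  rwa [LinearIsometryEquiv.norm_map] at h

/-- The linear terms gain `τ ‖z - T z‖²` and `2 τ ‖G z‖²`. The smallness of `τ` bounds the quadratic
error by `τ ‖z - T z‖² + τ ‖G z‖²`, leaving one `τ ‖G z‖²`. -/
theorem norm_forwardStep_sub_sq_le {T : E → E} (G : E →L[ℝ] E') {p : E}
    (hT : ∀ x, ‖T x - p‖ ≤ ‖x - p‖) (hG : G p = 0) {τ : ℝ} (hτ : 0 ≤ τ) (hτ2 : τ ≤ 1 / 2)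
    (hτG : τ * ‖G‖ ^ 2 ≤ 1 / 2) (z : E) :
    ‖forwardStep T G τ z - p‖ ^ 2 ≤ ‖z - p‖ ^ 2 - τ * ‖G z‖ ^ 2 := by
  set b := ContinuousLinearMap.adjoint G (G z)
  have h0 : forwardStep T G τ z - p = (z - p) - τ • ((z - T z) + b) := by
    rw [forwardStep]; abel
  have h1 : inner ℝ (z - p) b = ‖G z‖ ^ 2 := by
    rw [ContinuousLinearMap.adjoint_inner_right, map_sub, hG, sub_zero,
      real_inner_self_eq_norm_sq]
  have h2 : ‖z - T z‖ ^ 2 ≤ 2 * inner ℝ (z - p) (z - T z) := by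
    have h3 : T z - p = (z - p) - (z - T z) := by abel
    have h4 := pow_le_pow_left₀ (norm_nonneg _) (hT z) 2
    rw [h3, norm_sub_sq_real] at h4
    linarith
  have h5 : ‖b‖ ^ 2 ≤ ‖G‖ ^ 2 * ‖G z‖ ^ 2 := by
    rw [← mul_pow]
    exact pow_le_pow_left₀ (norm_nonneg _) (norm_adjoint_apply_le G _) 2
  have h6 : ‖(z - T z) + b‖ ^ 2 ≤ 2 * ‖z - T z‖ ^ 2 + 2 * ‖b‖ ^ 2 := by
    have h7 := pow_le_pow_left₀ (norm_nonneg _) (norm_add_le (z - T z) b) 2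
    nlinarith [sq_nonneg (‖z - T z‖ - ‖b‖)]
  rw [h0, norm_sub_sq_real, real_inner_smul_right, inner_add_right, h1, norm_smul, mul_pow,
    Real.norm_eq_abs, sq_abs]
  have e1 : τ ^ 2 * ‖(z - T z) + b‖ ^ 2 ≤
      τ ^ 2 * (2 * ‖z - T z‖ ^ 2 + 2 * (‖G‖ ^ 2 * ‖G z‖ ^ 2)) := by gcongr; linarith
  have e2 : τ * ‖z - T z‖ ^ 2 ≤ τ * (2 * inner ℝ (z - p) (z - T z)) :=
    mul_le_mul_of_nonneg_left h2 hτ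
  have e3 : τ * (τ * ‖z - T z‖ ^ 2) ≤ 1 / 2 * (τ * ‖z - T z‖ ^ 2) :=
    mul_le_mul_of_nonneg_right hτ2 (by positivity)
  have e4 : (τ * ‖G‖ ^ 2) * (τ * ‖G z‖ ^ 2) ≤ 1 / 2 * (τ * ‖G z‖ ^ 2) :=
    mul_le_mul_of_nonneg_right hτG (by positivity)
  linarith

/-- Here `G c = 0` is not assumed: this serves weak limits known only to be fixed by `T`, at the
price of a growth linear in `τ`. -/
theorem norm_forwardStep_sub_le {T : E → E} (G : E →L[ℝ] E') {c : E}
    (hT : ∀ x, ‖T x - c‖ ≤ ‖x - c‖) {τ : ℝ} (hτ : 0 ≤ τ) (hτ1 : τ ≤ 1) (z : E) :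
    ‖forwardStep T G τ z - c‖ ≤ ‖z - c‖ + τ * (‖G‖ * ‖G z‖) := by
  have h0 : forwardStep T G τ z - c = ((1 - τ) • (z - c) + τ • (T z - c)) -
      τ • ContinuousLinearMap.adjoint G (G z) := by
    rw [forwardStep]; module
  rw [h0]
  refine (norm_sub_le _ _).trans (add_le_add ((norm_add_le _ _).trans ?_) ?_)
  · rw [norm_smul, norm_smul, Real.norm_of_nonneg hτ, Real.norm_of_nonneg (sub_nonneg.2 hτ1)]
    nlinarith [hT z]
  · rw [norm_smul, Real.norm_of_nonneg hτ]
    exact mul_le_mul_of_nonneg_left (norm_adjoint_apply_le G _) hτ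

/-- Weak convergence of the relaxed forward iteration with vanishing steps, for a nonexpansive,
strongly quasi-nonexpansive map `T`, to a fixed point of `T` in the kernel of `G`. -/
theorem exists_weakLim_relaxed_forwardStep {T : E → E} (hT : ∀ x y, ‖T x - T y‖ ≤ ‖x - y‖)
    {κ : ℝ} (hκ : 0 < κ)
    (hTκ : ∀ p, T p = p → ∀ x, ‖T x - p‖ ^ 2 ≤ ‖x - p‖ ^ 2 - κ * ‖x - T x‖ ^ 2)
    (G : E →L[ℝ] E') {p₀ : E} (hp₀ : T p₀ = p₀) (hGp₀ : G p₀ = 0)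
    {a : ℝ} (ha : 0 < a) {α τ : ℕ → ℝ} (hα : ∀ n, a < α n ∧ α n < 1) (hτ : ∀ n, 0 < τ n)
    (hτ2 : ∀ n, τ n ≤ 1 / 2) (hτG : ∀ n, τ n * ‖G‖ ^ 2 ≤ 1 / 2) (hτ0 : Tendsto τ atTop (𝓝 0))
    (hdiv : Tendsto (fun n => ∑ i ∈ Finset.range n, τ i) atTop atTop) {z v : ℕ → E}
    (hv : ∀ n, v n = forwardStep T G (τ n) (z n))
    (hz : ∀ n, z (n + 1) = (1 - α n) • v n + α n • T (v n)) :
    ∃ p, (T p = p ∧ G p = 0) ∧ WeakLim atTop z p := by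
  have hquasi : ∀ c, T c = c → ∀ x, ‖T x - c‖ ≤ ‖x - c‖ := fun c hc x => by
    simpa only [hc] using hT x c
  have hrelax : ∀ c, T c = c → ∀ n,
      ‖z (n + 1) - c‖ ^ 2 ≤ ‖v n - c‖ ^ 2 - a * κ * ‖v n - T (v n)‖ ^ 2 := by
    intro c hc n
    obtain ⟨h1, h2⟩ := hα n
    have h3 := mul_le_mul_of_nonneg_left (hTκ c hc (v n)) (ha.trans h1).le
    rw [hz, norm_convexComb_sub_sq]
    have h4 : 0 ≤ α n * (1 - α n) * ‖v n - T (v n)‖ ^ 2 :=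
      mul_nonneg (mul_nonneg (ha.trans h1).le (sub_nonneg.2 h2.le)) (by positivity)
    have h5 : a * (κ * ‖v n - T (v n)‖ ^ 2) ≤ α n * (κ * ‖v n - T (v n)‖ ^ 2) :=
      mul_le_mul_of_nonneg_right h1.le (by positivity)
    linarith
  have hfejer : ∀ p, T p = p → G p = 0 → ∀ n, ‖z (n + 1) - p‖ ^ 2 ≤
      ‖z n - p‖ ^ 2 - τ n * ‖G (z n)‖ ^ 2 - a * κ * ‖v n - T (v n)‖ ^ 2 := by
    intro p hp hGp n
    have h1 := hrelax p hp n
    have h2 := norm_forwardStep_sub_sq_le G (hquasi p hp) hGp (hτ n).le (hτ2 n) (hτG n) (z n)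
    rw [← hv] at h2
    linarith
  have hanti : ∀ p, T p = p → G p = 0 → Antitone fun n => ‖z n - p‖ ^ 2 := by
    intro p hp hGp
    refine antitone_nat_of_succ_le fun n => ?_
    have h1 := hfejer p hp hGp n
    have h2 : 0 ≤ τ n * ‖G (z n)‖ ^ 2 := mul_nonneg (hτ n).le (by positivity)
    have h3 : 0 ≤ a * κ * ‖v n - T (v n)‖ ^ 2 := by positivity
    linarith
  have hdist : ∀ p, T p = p → G p = 0 → ∃ l, Tendsto (fun n => ‖z n - p‖ ^ 2) atTop (𝓝 l) :=
    fun p hp hGp => ⟨_, tendsto_atTop_ciInf (hanti p hp hGp)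
      ⟨0, by rintro _ ⟨n, rfl⟩; positivity⟩⟩
  set R := ‖z 0 - p₀‖ with hRdef
  have hR : ∀ n, ‖z n - p₀‖ ≤ R := fun n =>
    le_of_sq_le_sq (hanti p₀ hp₀ hGp₀ (Nat.zero_le n)) (norm_nonneg _)
  have hRc : ∀ c n, ‖z n - c‖ ≤ R + ‖p₀ - c‖ := fun c n =>
    (norm_sub_le_norm_sub_add_norm_sub _ p₀ _).trans (by gcongr; exact hR n)
  have hGR : ∀ n, ‖G (z n)‖ ≤ ‖G‖ * R := fun n => by
    have h := G.le_opNorm (z n - p₀)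
    rw [map_sub, hGp₀, sub_zero] at h
    exact h.trans (mul_le_mul_of_nonneg_left (hR n) (norm_nonneg _))
  -- asymptotic regularity
  have hreg : Tendsto (fun n => ‖z n - T (z n)‖) atTop (𝓝 0) := by
    obtain ⟨l, hl⟩ := hdist p₀ hp₀ hGp₀
    have h1 : Tendsto (fun n => ‖v n - T (v n)‖ ^ 2) atTop (𝓝 0) := by
      have h2 : Tendsto (fun n => (a * κ)⁻¹ * (‖z n - p₀‖ ^ 2 - ‖z (n + 1) - p₀‖ ^ 2)) atTop
          (𝓝 0) := by
        simpa using (hl.sub (hl.comp (tendsto_add_atTop_nat 1))).const_mul (a * κ)⁻¹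
      refine squeeze_zero (fun n => by positivity) (fun n => ?_) h2
      have h3 := hfejer p₀ hp₀ hGp₀ n
      have h4 : 0 ≤ τ n * ‖G (z n)‖ ^ 2 := mul_nonneg (hτ n).le (by positivity)
      rw [← div_eq_inv_mul, le_div_iff₀ (by positivity)]
      linarith
    have h2 : Tendsto (fun n => ‖v n - T (v n)‖) atTop (𝓝 0) := by
      simpa [Real.sqrt_sq] using h1.sqrt
    have h3 : Tendsto (fun n => ‖z n - v n‖) atTop (𝓝 0) := by
      have h4 : Tendsto (fun n => τ n * (2 * R + ‖G‖ * (‖G‖ * R))) atTop (𝓝 0) := by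
        simpa using hτ0.mul_const (2 * R + ‖G‖ * (‖G‖ * R))
      refine squeeze_zero (fun n => norm_nonneg _) (fun n => ?_) h4
      rw [hv, forwardStep, sub_sub_cancel, norm_smul, Real.norm_of_nonneg (hτ n).le]
      refine mul_le_mul_of_nonneg_left ((norm_add_le _ _).trans (add_le_add ?_ ?_)) (hτ n).le
      · have h5 := norm_sub_le_norm_sub_add_norm_sub (z n) p₀ (T (z n))
        rw [norm_sub_rev p₀] at h5
        linarith [hquasi p₀ hp₀ (z n), hR n]
      · exact (norm_adjoint_apply_le G _).trans
          (mul_le_mul_of_nonneg_left (hGR n) (norm_nonneg _))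
    have h4 : Tendsto (fun n => 2 * ‖z n - v n‖ + ‖v n - T (v n)‖) atTop (𝓝 0) := by
      simpa using (h3.const_mul 2).add h2
    refine squeeze_zero (fun n => norm_nonneg _) (fun n => ?_) h4
    have h5 := norm_sub_le_norm_sub_add_norm_sub (z n) (v n) (T (z n))
    have h6 := norm_sub_le_norm_sub_add_norm_sub (v n) (T (v n)) (T (z n))
    have h7 := hT (v n) (z n)
    rw [norm_sub_rev (v n) (z n)] at h7
    linarith
  have hsum : Summable fun n => τ n * ‖G (z n)‖ ^ 2 := by
    refine summable_of_sum_range_le (c := ‖z 0 - p₀‖ ^ 2)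
      (fun n => mul_nonneg (hτ n).le (by positivity)) fun n => ?_
    have h1 : ∀ n, ∑ i ∈ Finset.range n, τ i * ‖G (z i)‖ ^ 2 ≤
        ‖z 0 - p₀‖ ^ 2 - ‖z n - p₀‖ ^ 2 := by
      intro n
      induction n with
      | zero => simp
      | succ k ih =>
        rw [Finset.sum_range_succ]
        have h2 := hfejer p₀ hp₀ hGp₀ k
        have h3 : 0 ≤ a * κ * ‖v k - T (v k)‖ ^ 2 := by positivity
        linarith
    have := h1 n
    have : 0 ≤ ‖z n - p₀‖ ^ 2 := by positivity
    linarith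
  obtain ⟨m, hm, hm0, hmτ⟩ := exists_visit_of_summable_mul (fun n => (hτ n).le)
    (fun n => sq_nonneg ‖G (z n)‖) hsum hdiv
  have hGm : Tendsto (fun n => ‖G (z (m n))‖) atTop (𝓝 0) := by
    simpa [Real.sqrt_sq] using hm0.sqrt
  -- distances to fixed points of `T` hardly grow between `n` and `m n`
  have hdrift : ∀ c, T c = c → ∀ n k, n ≤ k →
      ‖z k - c‖ ≤ ‖z n - c‖ + (∑ j ∈ Finset.Ico n k, τ j) * (‖G‖ * (‖G‖ * R)) := by
    intro c hc n k hnk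
    induction k, hnk using Nat.le_induction with
    | base => simp
    | succ k hnk ih =>
      have h1 : ‖z (k + 1) - c‖ ≤ ‖v k - c‖ := by
        refine le_of_sq_le_sq ((hrelax c hc k).trans ?_) (norm_nonneg _)
        have : 0 ≤ a * κ * ‖v k - T (v k)‖ ^ 2 := by positivity
        linarith
      have h2 := norm_forwardStep_sub_le G (hquasi c hc) (hτ k).le
        ((hτ2 k).trans (by norm_num)) (z k)
      rw [← hv] at h2
      have h3 : τ k * (‖G‖ * ‖G (z k)‖) ≤ τ k * (‖G‖ * (‖G‖ * R)) :=
        mul_le_mul_of_nonneg_left (mul_le_mul_of_nonneg_left (hGR k) (norm_nonneg _)) (hτ k).le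
      rw [Finset.sum_Ico_succ_top hnk, add_mul]
      linarith
  have hbdd : ∀ n, ‖z n‖ ≤ R + ‖p₀‖ := fun n => by simpa using hRc 0 n
  refine exists_weakLim_of_opial (S := {p | T p = p ∧ G p = 0}) hbdd
    (fun p hp => hdist p hp.1 hp.2) fun F c hF hc => ?_
  have hTc : T c = c := hc.isFixedPt hT (hRc c) (hreg.mono_left hF)
  have hmtop : Tendsto m atTop atTop := tendsto_atTop_mono hm tendsto_id
  -- `c'` is the limit along the visits, where `G` is small, so it solves the problem; it remains to
  -- identify it with `c`.
  obtain ⟨c', hc'⟩ := exists_weakLim_ultrafilter F (z := fun n => z (m n)) fun n => hbdd (m n)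
  have hTc' : T c' = c' := hc'.isFixedPt hT (fun n => hRc c' (m n))
    ((hreg.comp hmtop).mono_left hF)
  have hGc' : G c' = 0 := hc'.map_eq_zero G (hGm.mono_left hF)
  suffices c = c' from ⟨hTc, this ▸ hGc'⟩
  obtain ⟨l, hl⟩ := hdist c' hTc' hGc'
  set e : ℕ → ℝ := fun n => (∑ j ∈ Finset.Ico n (m n), τ j) * (‖G‖ * (‖G‖ * R)) with he
  have he0 : Tendsto e atTop (𝓝 0) := by simpa using hmτ.mul_const (‖G‖ * (‖G‖ * R))
  -- The squared drift bound for `c`, expanded around `c'`. The left side tends to `0` because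
  -- distances to the solution `c'` converge; the right side tends to `-2 ‖c - c'‖²`.
  have hineq : ∀ n, ‖z (m n) - c'‖ ^ 2 - ‖z n - c'‖ ^ 2 ≤ 2 * inner ℝ (z n - c') (c' - c) -
      2 * inner ℝ (z (m n) - c') (c' - c) + (2 * (R + ‖p₀ - c‖) * e n + e n ^ 2) := by
    intro n
    have h1 := hdrift c hTc n (m n) (hm n)
    have h2 := pow_le_pow_left₀ (norm_nonneg _) h1 2
    rw [norm_sub_sq_expand (z (m n)) c c', add_sq, norm_sub_sq_expand (z n) c c'] at h2
    have h3 : 0 ≤ e n := mul_nonneg (Finset.sum_nonneg fun j _ => (hτ j).le)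
      (by positivity)
    have h4 := mul_le_mul_of_nonneg_right (hRc c n) h3
    simp only [he] at h4 ⊢
    linarith
  have hleft : Tendsto (fun n => ‖z (m n) - c'‖ ^ 2 - ‖z n - c'‖ ^ 2) (F : Filter ℕ)
      (𝓝 (l - l)) := ((hl.comp hmtop).sub hl).mono_left hF
  have herr : Tendsto (fun n => 2 * (R + ‖p₀ - c‖) * e n + e n ^ 2) (F : Filter ℕ) (𝓝 0) := by
    simpa using ((he0.const_mul (2 * (R + ‖p₀ - c‖))).add (he0.pow 2)).mono_left hF
  have hright := (((hc.sub_const c' (c' - c)).const_mul 2).sub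
    ((hc'.sub_const c' (c' - c)).const_mul 2)).add herr
  have hfin := le_of_tendsto_of_tendsto hleft hright (Eventually.of_forall hineq)
  rw [sub_self, sub_self, inner_zero_left, mul_zero, sub_zero, add_zero, ← neg_sub c c',
    inner_neg_right, real_inner_self_eq_norm_sq] at hfin
  have h0 : ‖c - c'‖ = 0 := by nlinarith [norm_nonneg (c - c')]
  exact sub_eq_zero.1 (norm_eq_zero.1 h0)

end Iteration

/-! ### Ishikawa-type maps of a nonexpansive map -/

section Ishikawa

variable {H : Type*} [NormedAddCommGroup H] [InnerProductSpace ℝ H]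

theorem norm_convexComb_sub_convexComb_le {r : ℝ} (hr0 : 0 ≤ r) (hr1 : r ≤ 1) {S : H → H}
    (hS : ∀ x y, ‖S x - S y‖ ≤ ‖x - y‖) (x y : H) :
    ‖((1 - r) • x + r • S x) - ((1 - r) • y + r • S y)‖ ≤ ‖x - y‖ := by
  have h : ((1 - r) • x + r • S x) - ((1 - r) • y + r • S y) =
      (1 - r) • (x - y) + r • (S x - S y) := by module
  rw [h]
  refine (norm_add_le _ _).trans ?_
  rw [norm_smul, norm_smul, Real.norm_of_nonneg hr0, Real.norm_of_nonneg (sub_nonneg.2 hr1)]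
  nlinarith [hS x y]

theorem norm_ishikawa_sub_le {η ζ : ℝ} (hη0 : 0 ≤ η) (hη1 : η ≤ 1) (hζ0 : 0 ≤ ζ) (hζ1 : ζ ≤ 1)
    {T : H → H} (hT : ∀ x y, ‖T x - T y‖ ≤ ‖x - y‖) (x y : H) :
    ‖ishikawa η ζ T x - ishikawa η ζ T y‖ ≤ ‖x - y‖ :=
  norm_convexComb_sub_convexComb_le (S := fun x => T ((1 - ζ) • x + ζ • T x)) hη0 hη1
    (fun x y => (hT _ _).trans (norm_convexComb_sub_convexComb_le hζ0 hζ1 hT x y)) x y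

/-- A fixed point satisfies `T ((1 - ζ) p + ζ T p) = p`, whence `‖p - T p‖ ≤ ζ ‖T p - p‖` with `ζ <
1`. -/
theorem ishikawa_eq_self_iff {η ζ : ℝ} (hη : 0 < η) (hζ0 : 0 ≤ ζ) (hζ1 : ζ < 1) {T : H → H}
    (hT : ∀ x y, ‖T x - T y‖ ≤ ‖x - y‖) {p : H} : ishikawa η ζ T p = p ↔ T p = p := by
  constructor
  · intro h
    have h1 : T ((1 - ζ) • p + ζ • T p) = p := by
      have h2 : η • (T ((1 - ζ) • p + ζ • T p) - p) = 0 := by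
        rw [ishikawa] at h
        rw [← sub_eq_zero.2 h]
        module
      exact sub_eq_zero.1 ((smul_eq_zero.1 h2).resolve_left hη.ne')
    have h3 := hT ((1 - ζ) • p + ζ • T p) p
    have h4 : ((1 - ζ) • p + ζ • T p) - p = ζ • (T p - p) := by module
    rw [h1, h4, norm_smul, Real.norm_of_nonneg hζ0, norm_sub_rev] at h3
    have h5 : ‖T p - p‖ = 0 := by nlinarith [norm_nonneg (T p - p)]
    exact sub_eq_zero.1 (norm_eq_zero.1 h5)
  · intro h
    rw [ishikawa, h, Convex.combo_self (sub_add_cancel 1 ζ), h,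
      Convex.combo_self (sub_add_cancel 1 η)]

/-- The map averages `x` with a point `w` no farther from `p`. The convex-combination identity loses
`η (1 - η) ‖x - w‖²`, and `x - w` is the displacement divided by `η`. -/
theorem norm_ishikawa_sub_sq_le {η ζ : ℝ} (hη0 : 0 < η) (hζ0 : 0 ≤ ζ) (hζ1 : ζ < 1)
    {T : H → H} (hT : ∀ x y, ‖T x - T y‖ ≤ ‖x - y‖) {p : H} (hp : ishikawa η ζ T p = p) (x : H) :
    ‖ishikawa η ζ T x - p‖ ^ 2 ≤
      ‖x - p‖ ^ 2 - (1 - η) / η * ‖x - ishikawa η ζ T x‖ ^ 2 := by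
  have hTp := (ishikawa_eq_self_iff hη0 hζ0 hζ1 hT).1 hp
  set w := T ((1 - ζ) • x + ζ • T x) with hw
  have h1 : ‖w - p‖ ≤ ‖x - p‖ := by
    have h2 := (hT ((1 - ζ) • x + ζ • T x) ((1 - ζ) • p + ζ • T p)).trans
      (norm_convexComb_sub_convexComb_le hζ0 hζ1.le hT x p)
    rwa [hTp, Convex.combo_self (sub_add_cancel 1 ζ), hTp] at h2
  have h3 : ishikawa η ζ T x = (1 - η) • x + η • w := rfl
  have h4 : x - ishikawa η ζ T x = η • (x - w) := by rw [h3]; module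
  rw [h4, h3, norm_convexComb_sub_sq, norm_smul, mul_pow, Real.norm_eq_abs, sq_abs]
  have h5 : (1 - η) / η * (η ^ 2 * ‖x - w‖ ^ 2) = η * (1 - η) * ‖x - w‖ ^ 2 := by field_simp
  have h6 := mul_le_mul_of_nonneg_left (pow_le_pow_left₀ (norm_nonneg _) h1 2) hη0.le
  rw [h5]
  linarith

end Ishikawa

/-! ### Reduction of the split problem to the Hilbert sum -/

section Product

variable {H₁ H₂ H₃ : Type*}
  [NormedAddCommGroup H₁] [InnerProductSpace ℝ H₁]
  [NormedAddCommGroup H₂] [InnerProductSpace ℝ H₂]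
  [NormedAddCommGroup H₃] [InnerProductSpace ℝ H₃]

/-- The product map on the Hilbert sum. -/
def prodMapL2 (U : H₁ → H₁) (V : H₂ → H₂) (z : WithLp 2 (H₁ × H₂)) : WithLp 2 (H₁ × H₂) :=
  WithLp.toLp 2 (U z.fst, V z.snd)

/-- The operator `(x, y) ↦ D₁ x - D₂ y` on the Hilbert sum. -/
noncomputable def splitDiff (D₁ : H₁ →L[ℝ] H₃) (D₂ : H₂ →L[ℝ] H₃) :
    WithLp 2 (H₁ × H₂) →L[ℝ] H₃ :=
  D₁.comp (WithLp.fstL 2 ℝ H₁ H₂) - D₂.comp (WithLp.sndL 2 ℝ H₁ H₂)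

theorem splitDiff_apply (D₁ : H₁ →L[ℝ] H₃) (D₂ : H₂ →L[ℝ] H₃) (z : WithLp 2 (H₁ × H₂)) :
    splitDiff D₁ D₂ z = D₁ z.fst - D₂ z.snd := rfl

variable [CompleteSpace H₁] [CompleteSpace H₂] [CompleteSpace H₃]

theorem adjoint_splitDiff_apply (D₁ : H₁ →L[ℝ] H₃) (D₂ : H₂ →L[ℝ] H₃) (u : H₃) :
    ContinuousLinearMap.adjoint (splitDiff D₁ D₂) u = WithLp.toLp 2
      (ContinuousLinearMap.adjoint D₁ u, -ContinuousLinearMap.adjoint D₂ u) := by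
  refine ext_inner_left ℝ fun z => ?_
  rw [ContinuousLinearMap.adjoint_inner_right, splitDiff_apply, WithLp.prod_inner_apply,
    inner_neg_right, ContinuousLinearMap.adjoint_inner_right,
    ContinuousLinearMap.adjoint_inner_right, inner_sub_left, sub_eq_add_neg]
  rfl

/-- Weak convergence of the simultaneous iteration for the split equality fixed-point problem. -/
theorem exists_weaklyTendsto_split {U : H₁ → H₁} {V : H₂ → H₂}
    (hU : ∀ x y, ‖U x - U y‖ ≤ ‖x - y‖) (hV : ∀ x y, ‖V x - V y‖ ≤ ‖x - y‖)
    {κ : ℝ} (hκ : 0 < κ)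
    (hUκ : ∀ p, U p = p → ∀ x, ‖U x - p‖ ^ 2 ≤ ‖x - p‖ ^ 2 - κ * ‖x - U x‖ ^ 2)
    (hVκ : ∀ p, V p = p → ∀ x, ‖V x - p‖ ^ 2 ≤ ‖x - p‖ ^ 2 - κ * ‖x - V x‖ ^ 2)
    (D₁ : H₁ →L[ℝ] H₃) (D₂ : H₂ →L[ℝ] H₃) (hne : (sefppSolutions U V D₁ D₂).Nonempty)
    {a : ℝ} (ha : 0 < a) {α τ : ℕ → ℝ} (hα : ∀ n, a < α n ∧ α n < 1) (hτ : ∀ n, 0 < τ n)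
    (hτ0 : Tendsto τ atTop (𝓝 0))
    (hdiv : Tendsto (fun n => ∑ i ∈ Finset.range n, τ i) atTop atTop)
    {x v : ℕ → H₁} {y w : ℕ → H₂}
    (hv : ∀ n, v n = (1 - τ n) • x n + τ n • U (x n) +
      τ n • (ContinuousLinearMap.adjoint D₁) (D₂ (y n) - D₁ (x n)))
    (hx : ∀ n, x (n + 1) = (1 - α n) • v n + α n • U (v n))
    (hw : ∀ n, w n = (1 - τ n) • y n + τ n • V (y n) +
      τ n • (ContinuousLinearMap.adjoint D₂) (D₁ (x n) - D₂ (y n)))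
    (hy : ∀ n, y (n + 1) = (1 - α n) • w n + α n • V (w n)) :
    ∃ p q, (p, q) ∈ sefppSolutions U V D₁ D₂ ∧ WeaklyTendsto x p ∧ WeaklyTendsto y q := by
  set T := prodMapL2 U V with hTdef
  set G := splitDiff D₁ D₂ with hGdef
  have hfix : ∀ z, T z = z ↔ U z.fst = z.fst ∧ V z.snd = z.snd := fun z =>
    ⟨fun h => ⟨congrArg WithLp.fst h, congrArg WithLp.snd h⟩,
      fun h => congrArg (WithLp.toLp 2) (Prod.ext h.1 h.2)⟩
  have hT : ∀ z z', ‖T z - T z'‖ ≤ ‖z - z'‖ := by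
    intro z z'
    refine le_of_sq_le_sq ?_ (norm_nonneg _)
    rw [WithLp.prod_norm_sq_eq_of_L2, WithLp.prod_norm_sq_eq_of_L2]
    exact add_le_add (pow_le_pow_left₀ (norm_nonneg _) (hU _ _) 2)
      (pow_le_pow_left₀ (norm_nonneg _) (hV _ _) 2)
  have hTκ : ∀ p, T p = p → ∀ z, ‖T z - p‖ ^ 2 ≤ ‖z - p‖ ^ 2 - κ * ‖z - T z‖ ^ 2 := by
    intro p hp z
    have h1 := hUκ _ ((hfix p).1 hp).1 z.fst
    have h2 := hVκ _ ((hfix p).1 hp).2 z.snd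
    rw [WithLp.prod_norm_sq_eq_of_L2, WithLp.prod_norm_sq_eq_of_L2, WithLp.prod_norm_sq_eq_of_L2]
    simp only [WithLp.sub_fst, WithLp.sub_snd, hTdef, prodMapL2, WithLp.toLp_fst,
      WithLp.toLp_snd]
    linarith
  obtain ⟨⟨p₀, q₀⟩, hp₀, hq₀, hpq₀⟩ := hne
  -- The step bounds hold from some `n₀` on because `τ → 0`. The iteration is restarted there, which
  -- changes neither weak limits nor the divergence of `∑ τ`.
  have hτev : ∀ᶠ n in atTop, τ n ≤ 1 / 2 ∧ τ n * ‖G‖ ^ 2 ≤ 1 / 2 := by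
    refine (hτ0.eventually_le_const (by norm_num)).and ?_
    refine Tendsto.eventually_le_const (v := 0) (by norm_num) ?_
    simpa using hτ0.mul_const (‖G‖ ^ 2)
  obtain ⟨n₀, hn₀⟩ := eventually_atTop.1 hτev
  have hdiv' : Tendsto (fun n => ∑ i ∈ Finset.range n, τ (i + n₀)) atTop atTop := by
    have h1 := tendsto_atTop_add_const_right atTop (-∑ i ∈ Finset.range n₀, τ i)
      (hdiv.comp (tendsto_add_atTop_nat n₀))
    refine h1.congr fun n => ?_
    simp only [Function.comp_apply]
    rw [add_comm n n₀, Finset.sum_range_add]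
    simp only [add_comm n₀]
    ring
  obtain ⟨z, ⟨hz1, hz2⟩, hz⟩ := exists_weakLim_relaxed_forwardStep hT hκ hTκ G
    (p₀ := WithLp.toLp 2 (p₀, q₀)) ((hfix _).2 ⟨hp₀, hq₀⟩)
    (by rw [hGdef, splitDiff_apply]; exact sub_eq_zero.2 hpq₀) ha
    (α := fun n => α (n + n₀)) (τ := fun n => τ (n + n₀)) (fun n => hα _) (fun n => hτ _)
    (fun n => (hn₀ _ (Nat.le_add_left _ _)).1) (fun n => (hn₀ _ (Nat.le_add_left _ _)).2)
    (hτ0.comp (tendsto_add_atTop_nat n₀)) hdiv'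
    (z := fun n => WithLp.toLp 2 (x (n + n₀), y (n + n₀)))
    (v := fun n => WithLp.toLp 2 (v (n + n₀), w (n + n₀)))
    (fun n => by
      rw [forwardStep, hGdef, adjoint_splitDiff_apply, splitDiff_apply, hv, hw]
      refine congrArg (WithLp.toLp 2) (Prod.ext ?_ ?_)
      · change _ = x (n + n₀) - τ (n + n₀) • ((x (n + n₀) - U (x (n + n₀))) +
          ContinuousLinearMap.adjoint D₁ (D₁ (x (n + n₀)) - D₂ (y (n + n₀))))
        simp only [map_sub]
        module
      · change _ = y (n + n₀) - τ (n + n₀) • ((y (n + n₀) - V (y (n + n₀))) +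
          -ContinuousLinearMap.adjoint D₂ (D₁ (x (n + n₀)) - D₂ (y (n + n₀))))
        simp only [map_sub]
        module)
    (fun n => by
      rw [show n + 1 + n₀ = (n + n₀) + 1 by ring, hx, hy]
      rfl)
  refine ⟨z.fst, z.snd, ⟨((hfix z).1 hz1).1, ((hfix z).1 hz1).2, sub_eq_zero.1 hz2⟩, ?_, ?_⟩
  -- Testing against `(u, 0)`, and then `(0, u)`, recovers the components.
  · refine weaklyTendsto_iff_weakLim.2 fun u => (tendsto_add_atTop_iff_nat n₀).1 ?_
    simpa [WithLp.prod_inner_apply] using hz (WithLp.toLp 2 (u, 0))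
  · refine weaklyTendsto_iff_weakLim.2 fun u => (tendsto_add_atTop_iff_nat n₀).1 ?_
    simpa [WithLp.prod_inner_apply] using hz (WithLp.toLp 2 (0, u))

end Product

end SplitConvex

/-! ### The split convex minimization theorem -/

theorem theorem4p3
    {H₁ H₂ H₃ : Type*}
    [NormedAddCommGroup H₁] [InnerProductSpace ℝ H₁] [CompleteSpace H₁]
    [NormedAddCommGroup H₂] [InnerProductSpace ℝ H₂] [CompleteSpace H₂]
    [NormedAddCommGroup H₃] [InnerProductSpace ℝ H₃] [CompleteSpace H₃]
    (K₁ : Set H₁) (hK₁ : IsClosed K₁) (hK₁c : Convex ℝ K₁)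
    (K₂ : Set H₂) (hK₂ : IsClosed K₂) (hK₂c : Convex ℝ K₂)
    (M : H₁ → EReal) (hM : SplitConvex.IsProperLscConvexOn M K₁)
    (N : H₂ → EReal) (hN : SplitConvex.IsProperLscConvexOn N K₂)
    (D₁ : H₁ →L[ℝ] H₃) (D₂ : H₂ →L[ℝ] H₃)
    (hne : (SplitConvex.scmpSolutions K₁ K₂ M N D₁ D₂).Nonempty)
    -- the resolvents of parameter `lam` of `h(t, y) = M y - M t` and `l(t, y) = N y - N t`
    (lam : ℝ) (hlam : 0 < lam)
    (Rh : H₁ → H₁)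
    (hRh : Rh = SplitConvex.resolventMap K₁ lam (SplitConvex.minBifunction M))
    (Rl : H₂ → H₂)
    (hRl : Rl = SplitConvex.resolventMap K₂ lam (SplitConvex.minBifunction N)) :
    -- the resolvents are everywhere defined and single-valued
    (∀ s, SplitConvex.biResolvent K₁ lam (SplitConvex.minBifunction M) s = {Rh s}) ∧
    (∀ s, SplitConvex.biResolvent K₂ lam (SplitConvex.minBifunction N) s = {Rl s}) ∧
    -- the two problems have the same solutions
    SplitConvex.scmpSolutions K₁ K₂ M N D₁ D₂ = SplitConvex.sefppSolutions Rh Rl D₁ D₂ ∧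
    -- convergence of the iteration built from the Ishikawa-type maps `U` and `V`
    ∀ (L : NNReal) (_hL : LipschitzWith L Rh)
      (η ζ : ℝ) (_hη : 0 < η) (_hηζ : η < ζ) (_hζ : ζ < 1 / (1 + Real.sqrt (1 + (L : ℝ) ^ 2)))
      (U : H₁ → H₁) (_hU : U = SplitConvex.ishikawa η ζ Rh)
      (V : H₂ → H₂) (_hV : V = SplitConvex.ishikawa η ζ Rl)
      -- the parameters; the second condition on `τ` is `τ n < 2 / (L₁ + L₂)`,
      -- which is no restriction if `L₁ + L₂ = 0`
      (a : ℝ) (_ha : 0 < a) (α : ℕ → ℝ) (_hα : ∀ n, a < α n ∧ α n < 1)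
      (τ : ℕ → ℝ) (_hτ_pos : ∀ n, 0 < τ n)
      (_hτ_lt : ∀ n, τ n * (‖(ContinuousLinearMap.adjoint D₁).comp D₁‖ +
        ‖(ContinuousLinearMap.adjoint D₂).comp D₂‖) < 2)
      (_hτ_lim : Tendsto τ atTop (𝓝 0))
      (_hτ_sum : Tendsto (fun n => ∑ i ∈ Finset.range n, τ i) atTop atTop)
      -- the iteration, from an arbitrary starting point `(x 0, y 0)`
      (x v : ℕ → H₁) (y w : ℕ → H₂)
      (_hv : ∀ n, v n = (1 - τ n) • x n + τ n • U (x n) +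
        τ n • (ContinuousLinearMap.adjoint D₁) (D₂ (y n) - D₁ (x n)))
      (_hx : ∀ n, x (n + 1) = (1 - α n) • v n + α n • U (v n))
      (_hw : ∀ n, w n = (1 - τ n) • y n + τ n • V (y n) +
        τ n • (ContinuousLinearMap.adjoint D₂) (D₁ (x n) - D₂ (y n)))
      (_hy : ∀ n, y (n + 1) = (1 - α n) • w n + α n • V (w n)),
      ∃ p q, (p, q) ∈ SplitConvex.scmpSolutions K₁ K₂ M N D₁ D₂ ∧
        SplitConvex.WeaklyTendsto x p ∧ SplitConvex.WeaklyTendsto y q := by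
  have hR₁ : ∀ s, SplitConvex.biResolvent K₁ lam (SplitConvex.minBifunction M) s = {Rh s} := by
    obtain ⟨z, hz1, -, hz3, -, -⟩ := hne
    exact fun s => hRh ▸ hM.biResolvent_eq_singleton hK₁ hK₁c hlam hz1 hz3 s
  have hR₂ : ∀ s, SplitConvex.biResolvent K₂ lam (SplitConvex.minBifunction N) s = {Rl s} := by
    obtain ⟨z, -, hz2, -, hz4, -⟩ := hne
    exact fun s => hRl ▸ hN.biResolvent_eq_singleton hK₂ hK₂c hlam hz2 hz4 s
  have hfix₁ : ∀ p, Rh p = p ↔ p ∈ K₁ ∧ IsMinOn M K₁ p := fun p => by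
    rw [← hM.mem_biResolvent_self_iff (lam := lam), hR₁, Set.mem_singleton_iff, eq_comm]
  have hfix₂ : ∀ q, Rl q = q ↔ q ∈ K₂ ∧ IsMinOn N K₂ q := fun q => by
    rw [← hN.mem_biResolvent_self_iff (lam := lam), hR₂, Set.mem_singleton_iff, eq_comm]
  have hnon₁ : ∀ s t, ‖Rh s - Rh t‖ ≤ ‖s - t‖ := fun s t =>
    hM.biResolvent_norm_sub_le hlam (hR₁ s ▸ Set.mem_singleton _) (hR₁ t ▸ Set.mem_singleton _)
  have hnon₂ : ∀ s t, ‖Rl s - Rl t‖ ≤ ‖s - t‖ := fun s t =>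
    hN.biResolvent_norm_sub_le hlam (hR₂ s ▸ Set.mem_singleton _) (hR₂ t ▸ Set.mem_singleton _)
  have hsol : SplitConvex.scmpSolutions K₁ K₂ M N D₁ D₂ =
      SplitConvex.sefppSolutions Rh Rl D₁ D₂ := by
    ext z
    simp only [SplitConvex.scmpSolutions, SplitConvex.sefppSolutions, Set.mem_ofPred_eq,
      Function.mem_fixedPoints_iff, hfix₁, hfix₂]
    tauto
  refine ⟨hR₁, hR₂, hsol, ?_⟩
  intro L _ η ζ hη hηζ hζ U hU V hV a ha α hα τ hτ _ hτ0 hdiv x v y w hv hx hw hy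
  have hζ1 : ζ < 1 := by
    refine hζ.trans_le ((div_le_one (by positivity)).2 ?_)
    linarith [Real.sqrt_nonneg (1 + (L : ℝ) ^ 2)]
  have hζ0 : 0 ≤ ζ := (hη.trans hηζ).le
  have hη1 : η < 1 := hηζ.trans hζ1
  have hsol' : SplitConvex.sefppSolutions U V D₁ D₂ =
      SplitConvex.sefppSolutions Rh Rl D₁ D₂ := by
    ext z
    simp only [SplitConvex.sefppSolutions, Set.mem_ofPred_eq, Function.mem_fixedPoints_iff, hU, hV,
      SplitConvex.ishikawa_eq_self_iff hη hζ0 hζ1 hnon₁,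
      SplitConvex.ishikawa_eq_self_iff hη hζ0 hζ1 hnon₂]
  rw [hsol, ← hsol'] at hne ⊢
  subst hU hV
  exact SplitConvex.exists_weaklyTendsto_split
    (SplitConvex.norm_ishikawa_sub_le hη.le hη1.le hζ0 hζ1.le hnon₁)
    (SplitConvex.norm_ishikawa_sub_le hη.le hη1.le hζ0 hζ1.le hnon₂)
    (div_pos (sub_pos.2 hη1) hη)
    (fun p hp => SplitConvex.norm_ishikawa_sub_sq_le hη hζ0 hζ1 hnon₁ hp)
    (fun q hq => SplitConvex.norm_ishikawa_sub_sq_le hη hζ0 hζ1 hnon₂ hq)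
    D₁ D₂ hne ha hα hτ hτ0 hdiv hv hx hw hy
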